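/- Let $H=(V,E,w)$ be a finite hypergraph with nonempty edges and edge weights $w_e\ge 0$ such that every vertex weight $w_u:=\sum_{e\ni u}w_e$ is positive. Put $W:=\mathrm{diag}(w_u)_{u\in V}$ and $[e]:=e\cup\{0\}$, where $0$ is a special index that is not a vertex, and let each edge $e$ carry constants $\beta^e_j\ge 0$ $(j\in[e])$ with $\sum_{j\in[e]}\beta^e_j=1$. For $f\in\mathbb R^V$ let $M_e:=\max_{s\in e}f_s$, $m_e:=\min_{i\in e}f_i$, let $S_e(f)$ and $I_e(f)$ be the sets of vertices of $e$ at which $f$ attains $M_e$ and $m_e$ respectively, and put $$Q(f):=\sum_{e\in E}w_e\Big\{\beta^e_0\max_{s,i\in e}(f_s-f_i)^2+\sum_{j\in e}\beta^e_j\big[(M_e-f_j)^2+(f_j-m_e)^2\big]\Big\}.$$ For $x\neq 0$ in $\mathbb R^V$ and $f:=W^{-1/2}x$, the normalized discrepancy ratio is $D(x):=Q(f)/\sum_{u}w_uf_u^2$. *Diffusion with mediators.* We say that $r\in\mathbb R^V$ is a derivative $\frac{df}{dt}$ of the diffusion process in the state $f$ if there are reals $\varphi'_u(e,j)$ $(e\in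 E,\ j\in[e],\ u\in e)$, the net rate of measure flowing into $u$ due to $(e,j)$, such that: (R0) $w_ur_u=\sum_{e\ni u}\sum_{j\in[e]}\varphi'_u(e,j)$ for all $u\in V$; (R1) for $u\ne j$, $\varphi'_u(e,j)<0$ implies $u\in S_e(f)$, and $\varphi'_u(e,j)>0$ implies $u\in I_e(f)$; (R2) for every $e$, $-\sum_{u\in S_e(f)}\varphi'_u(e,0)=w_e\beta^e_0(M_e-m_e)=\sum_{u\in I_e(f)}\varphi'_u(e,0)$; for every $j\in e$, $-\sum_{u\in S_e(f)\setminus\{j\}}\varphi'_u(e,j)=w_e\beta^e_j(M_e-f_j)$, $\ \sum_{u\in I_e(f)\setminus\{j\}}\varphi'_u(e,j)=w_e\beta^e_j(f_j-m_e)$ and $\varphi'_j(e,j)=w_e\beta^e_j(M_e+m_e-2f_j)$; and if $M_e=m_e$, then $\varphi'_u(e,j)=0$ for all $u\in e$, $j\in[e]$; (R3) for $u\neq j$, $\varphi'_u(e,j)<0$ implies $r_u=\max_{s\in S_e(f)}r_s$, and $\varphi'_u(e,j)>0$ implies $r_u=\min_{i\in I_e(f)}r_i$. **Theorem.** For every $f\in\mathbb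 R^V$ the rules (R0)–(R3) determine $r=\frac{df}{dt}$ uniquely, so that there is an operator $L_w f:=-\frac{df}{dt}$ and an induced normalized Laplacian $\mathcal L:=W^{1/2}L_wW^{-1/2}:\mathbb R^V\to\mathbb R^V$ (in general nonlinear). It satisfies $$\frac{\langle x,\mathcal L x\rangle}{\langle x,x\rangle}=D(x)\qquad\text{for every } x\neq 0 .$$ Moreover, if $|V|\ge 2$, the minimum $\gamma_2:=\min_{0\ne x\perp W^{1/2}\mathbf 1}D(x)$ exists and is an eigenvalue of $\mathcal L$, that is, $\mathcal Lx=\gamma_2x$ for some $x\ne0$; and every minimizer $x_2$ (that is, $0\neq x_2\perp W^{1/2}\mathbf 1$ with $D(x_2)=\gamma_2$) satisfies $\mathcal Lx_2=\gamma_2x_2$. -/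

import Mathlib

open Finset

/-- A finite edge-weighted hypergraph on the vertex set `V` with edges indexed by `E`, together
with mediator constants `β e j` for `j ∈ [e] = e ∪ {0}`; the special index `0` is `none`, the
vertex `j` is `some j`. Every vertex has positive weight `∑_{e ∋ i} w_e`. -/
structure MediatorHypergraph (V E : Type*) [Fintype V] [DecidableEq V] [Fintype E] where
  /-- the vertex set of an edge -/
  edge : E → Finset V
  edge_nonempty : ∀ e, (edge e).Nonempty
  /-- the weight of an edge -/
  w : E → ℝ
  w_nonneg : ∀ e, 0 ≤ w e
  vertex_pos : ∀ i, 0 < ∑ e with i ∈ edge e, w e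
  /-- the mediator constants -/
  β : E → Option V → ℝ
  β_nonneg : ∀ e, ∀ j ∈ insertNone (edge e), 0 ≤ β e j
  β_sum : ∀ e, ∑ j ∈ insertNone (edge e), β e j = 1

namespace MediatorHypergraph

variable {V E : Type*} [Fintype V] [DecidableEq V] [Fintype E]

/-- The weight `w_i` of a vertex. -/
def vw (H : MediatorHypergraph V E) (i : V) : ℝ := ∑ e with i ∈ H.edge e, H.w e

/-- The index set `[e] = e ∪ {0}`. -/
def idx (H : MediatorHypergraph V E) (e : E) : Finset (Option V) := insertNone (H.edge e)

/-- `max_{s ∈ e} f_s`. -/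
noncomputable def fmax (H : MediatorHypergraph V E) (e : E) (f : V → ℝ) : ℝ :=
  (H.edge e).sup' (H.edge_nonempty e) f

/-- `min_{i ∈ e} f_i`. -/
noncomputable def fmin (H : MediatorHypergraph V E) (e : E) (f : V → ℝ) : ℝ :=
  (H.edge e).inf' (H.edge_nonempty e) f

/-- `max_{s,i ∈ e} (f_s - f_i)`. -/
noncomputable def maxDiff (H : MediatorHypergraph V E) (e : E) (f : V → ℝ) : ℝ :=
  (H.edge e ×ˢ H.edge e).sup' ((H.edge_nonempty e).product (H.edge_nonempty e))
    fun p => f p.1 - f p.2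

/-- `max_{s,i ∈ e} (f_s - f_i)²`. -/
noncomputable def maxSqDiff (H : MediatorHypergraph V E) (e : E) (f : V → ℝ) : ℝ :=
  (H.edge e ×ˢ H.edge e).sup' ((H.edge_nonempty e).product (H.edge_nonempty e))
    fun p => (f p.1 - f p.2) ^ 2

/-- `S_e(f)`, the vertices of `e` of maximum density. -/
noncomputable def S (H : MediatorHypergraph V E) (e : E) (f : V → ℝ) : Finset V :=
  {u ∈ H.edge e | f u = H.fmax e f}

/-- `I_e(f)`, the vertices of `e` of minimum density. -/
noncomputable def I (H : MediatorHypergraph V E) (e : E) (f : V → ℝ) : Finset V :=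
  {u ∈ H.edge e | f u = H.fmin e f}

/-- The generalized quadratic form `Q`. -/
noncomputable def Q (H : MediatorHypergraph V E) (f : V → ℝ) : ℝ :=
  ∑ e, H.w e * (H.β e none * H.maxSqDiff e f +
    ∑ j ∈ H.edge e, H.β e (some j) * ((H.fmax e f - f j) ^ 2 + (f j - H.fmin e f) ^ 2))

/-- The discrepancy ratio `D_w` on the density space. -/
noncomputable def Dw (H : MediatorHypergraph V E) (f : V → ℝ) : ℝ :=
  H.Q f / ∑ u, H.vw u * f u ^ 2

/-- The vector `W^{1/2} f`. -/
noncomputable def toNormalized (H : MediatorHypergraph V E) (f : V → ℝ) : V → ℝ :=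
  fun u => √(H.vw u) * f u

/-- The vector `W^{-1/2} x`. -/
noncomputable def toDensity (H : MediatorHypergraph V E) (x : V → ℝ) : V → ℝ :=
  fun u => (√(H.vw u))⁻¹ * x u

/-- The normalized discrepancy ratio. -/
noncomputable def D (H : MediatorHypergraph V E) (x : V → ℝ) : ℝ := H.Dw (H.toDensity x)

/-- The rules of the diffusion process with mediators in the state with density vector `f`:
`r` is the vector `df/dt` and `φ e j u` is the net rate of measure flowing into the vertex `u ∈ e`
due to the pair `(e, j)`, `j ∈ [e]`. Flows between `S_e(f)` (or `I_e(f)`) and a mediator `j` are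
flows between `j` and the vertices other than `j`. -/
structure DiffusionRules (H : MediatorHypergraph V E) (f r : V → ℝ)
    (φ : E → Option V → V → ℝ) : Prop where
  /-- the density changes at the net rate of incoming measure divided by the vertex weight -/
  rate : ∀ u, H.vw u * r u = ∑ e with u ∈ H.edge e, ∑ j ∈ H.idx e, φ e j u
  /-- only vertices of maximum density lose measure, mediators aside -/
  lose : ∀ e, ∀ j ∈ H.idx e, ∀ u ∈ H.edge e, φ e j u < 0 → some u ≠ j → u ∈ H.S e f
  /-- only vertices of minimum density gain measure, mediators aside -/
  gain : ∀ e, ∀ j ∈ H.idx e, ∀ u ∈ H.edge e, 0 < φ e j u → some u ≠ j → u ∈ H.I e f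
  /-- direct flow out of `S_e(f)` -/
  direct_out : ∀ e, -∑ u ∈ H.S e f, φ e none u = H.w e * H.β e none * H.maxDiff e f
  /-- direct flow into `I_e(f)` -/
  direct_in : ∀ e, ∑ u ∈ H.I e f, φ e none u = H.w e * H.β e none * H.maxDiff e f
  /-- flow from `S_e(f)` to the mediator `j` -/
  med_out : ∀ e, ∀ j ∈ H.edge e,
    -∑ u ∈ (H.S e f).erase j, φ e (some j) u = H.w e * H.β e (some j) * (H.fmax e f - f j)
  /-- flow from the mediator `j` to `I_e(f)` -/
  med_in : ∀ e, ∀ j ∈ H.edge e,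
    ∑ u ∈ (H.I e f).erase j, φ e (some j) u = H.w e * H.β e (some j) * (f j - H.fmin e f)
  /-- net rate of flow received by the mediator `j` -/
  med_net : ∀ e, ∀ j ∈ H.edge e,
    φ e (some j) j = H.w e * H.β e (some j) * (H.fmax e f + H.fmin e f - 2 * f j)
  /-- an edge on which the density is constant moves no measure: measure flows only from higher
  to lower density, at a rate proportional to the difference -/
  no_flow : ∀ e, H.fmax e f = H.fmin e f → ∀ j ∈ H.idx e, ∀ u ∈ H.edge e, φ e j u = 0
  /-- a non-mediator that loses measure has the largest derivative in `S_e(f)` -/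
  lose_first : ∀ e, ∀ j ∈ H.idx e, ∀ u ∈ H.edge e, φ e j u < 0 → some u ≠ j →
    ∀ s ∈ H.S e f, r s ≤ r u
  /-- a non-mediator that gains measure has the smallest derivative in `I_e(f)` -/
  gain_first : ∀ e, ∀ j ∈ H.idx e, ∀ u ∈ H.edge e, 0 < φ e j u → some u ≠ j →
    ∀ i ∈ H.I e f, r u ≤ r i

/-- `Lw` is the operator `f ↦ -df/dt` on the density space: in every state `f` the rules of the
diffusion process determine `df/dt` uniquely, and it is `-Lw f`. -/
def IsDensityOperator (H : MediatorHypergraph V E) (Lw : (V → ℝ) → V → ℝ) : Prop :=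
  ∀ f r, (∃ φ, H.DiffusionRules f r φ) ↔ r = -Lw f

/-- `L = W^{1/2} Lw W^{-1/2}` is the normalized Laplacian induced by the diffusion process. -/
def IsNormalizedLaplacian (H : MediatorHypergraph V E) (L : (V → ℝ) → V → ℝ) : Prop :=
  ∃ Lw, H.IsDensityOperator Lw ∧ ∀ x, L x = H.toNormalized (Lw (H.toDensity x))

/-- The nonzero vectors orthogonal to `W^{1/2} 1`. -/
def feasible (H : MediatorHypergraph V E) : Set (V → ℝ) :=
  {x | x ≠ 0 ∧ x ⬝ᵥ H.toNormalized 1 = 0}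

end MediatorHypergraph

/-- The Rayleigh quotient `⟨x, L x⟩ / ⟨x, x⟩` of a possibly nonlinear operator on `ℝ^V`. -/
noncomputable def rayleigh {V : Type*} [Fintype V] (L : (V → ℝ) → V → ℝ) (x : V → ℝ) : ℝ :=
  (x ⬝ᵥ L x) / (x ⬝ᵥ x)

/-! Write ⟨r, g⟩ = ∑ w_u r_u g_u. Rule (R2) fixes how much measure leaves and enters the extremal
sets of each edge, so pairing a rate vector r with a test vector g leaves open only which extremal
vertices carry the flow. The worst choice gives ⟨r, g⟩ ≥ -∑ `variation`, where the sum is half the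
one-sided derivative of Q at f in direction g. Rule (R3) says that r attains this bound for g = r.

Uniqueness follows: two solutions satisfy ‖r'‖² ≤ ⟨r, r'⟩ and ‖r‖² ≤ ⟨r', r⟩, hence ‖r - r'‖² ≤ 0.
Existence is variational: among all ways to distribute the prescribed flows over the extremal sets,
one minimizing ‖r‖² obeys (R3) (`exists_extremal_distribution`).

For g = f equality holds because f is constant on each extremal set, so ⟨r, f⟩ = -Q(f), which is the
Rayleigh identity. For a minimizer f with value γ, moving along r lowers Q at rate at least 2‖r‖²,
while γ‖f + tr‖² decreases at rate 2γQ(f). Minimality forces ‖r‖² ≤ γQ(f), and then ‖r + γf‖² = ‖r‖²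
- γQ(f) ≤ 0. A minimizer exists by scale invariance and compactness. -/

/-! ### One-sided optimality and extremal distributions -/

open Filter Topology in
theorem nonneg_of_eventually_nonneg_quadratic {a c : ℝ}
    (h : ∀ᶠ t in 𝓝[>] (0 : ℝ), 0 ≤ a * t + c * t ^ 2) : 0 ≤ a := by
  have hlim : Tendsto (fun t : ℝ => a + c * t) (𝓝[>] 0) (𝓝 a) := by
    have : Tendsto (fun t : ℝ => a + c * t) (𝓝 0) (𝓝 (a + c * 0)) :=
      Continuous.tendsto (by fun_prop) 0
    simpa using this.mono_left nhdsWithin_le_nhds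
  refine ge_of_tendsto hlim ?_
  filter_upwards [h, self_mem_nhdsWithin] with t ht ht0
  have ht0 : 0 < t := ht0
  refine nonneg_of_mul_nonneg_left (b := t) ?_ ht0
  linarith [show (a + c * t) * t = a * t + c * t ^ 2 by ring]

/-- Mass distributions on the sets `A i` minimizing a weighted norm of the resulting flow put their
mass only where the rate `r`, weighted by the flow strength `c i`, is smallest. -/
theorem exists_extremal_distribution {V ι : Type*} [Fintype V] [DecidableEq V] [Fintype ι]
    (w b : V → ℝ) (hw : ∀ u, 0 < w u) (A : ι → Finset V) (hA : ∀ i, (A i).Nonempty)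
    (c : ι → ℝ) :
    ∃ p : ι → V → ℝ, (∀ i u, 0 ≤ p i u) ∧ (∀ i, ∀ u ∉ A i, p i u = 0) ∧
      (∀ i, ∑ u ∈ A i, p i u = 1) ∧
      ∀ r : V → ℝ, (∀ u, w u * r u = b u + ∑ i, c i * p i u) →
        ∀ i, ∀ u ∈ A i, 0 < p i u → ∀ v ∈ A i, c i * r u ≤ c i * r v := by
  classical
  let Δ : ι → Set (V → ℝ) := fun i => stdSimplex ℝ V ∩ {x | ∀ u ∉ A i, x u = 0}
  have hΔ : ∀ i, IsCompact (Δ i) := fun i => by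
    refine (isCompact_stdSimplex ℝ V).inter_right ?_
    have : {x : V → ℝ | ∀ u ∉ A i, x u = 0} = ⋂ u, ⋂ (_ : u ∉ A i), {x | x u = 0} := by
      ext; simp
    rw [this]
    exact isClosed_iInter fun u => isClosed_iInter fun _ =>
      isClosed_eq (continuous_apply u) continuous_const
  have hne : (Set.univ.pi Δ).Nonempty := by
    choose a ha using hA
    refine ⟨fun i => Pi.single (a i) 1, fun i _ => ⟨single_mem_stdSimplex ℝ (a i), ?_⟩⟩
    intro u hu
    exact Pi.single_eq_of_ne (fun h : u = a i => hu (h.symm ▸ ha i)) _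
  -- In terms of the rate r, the objective is ∑ w_u r_u².
  obtain ⟨p, hp, hmin⟩ := (isCompact_univ_pi hΔ).exists_isMinOn hne
    (f := fun p => ∑ u, (b u + ∑ i, c i * p i u) ^ 2 / w u)
    (Continuous.continuousOn (by fun_prop))
  have hp0 : ∀ i u, 0 ≤ p i u := fun i u => (hp i trivial).1.1 u
  have hpA : ∀ i, ∀ u ∉ A i, p i u = 0 := fun i => (hp i trivial).2
  have hp1 : ∀ i, ∑ u, p i u = 1 := fun i => (hp i trivial).1.2
  refine ⟨p, hp0, hpA, fun i => ?_, fun r hr i u hu hpu v hv => ?_⟩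
  · rw [← hp1 i]
    exact sum_subset (subset_univ _) fun u _ h => hpA i u h
  -- Perturb the minimizer by moving a little of the mass of distribution i from u to v.
  let δ : V → ℝ := Pi.single v 1 - Pi.single u 1
  have hδ : ∑ x, δ x = 0 := by simp [δ]
  have hrδ : ∑ x, r x * δ x = r v - r u := by
    simp [δ, mul_sub, Pi.single_apply]
  have key : 0 ≤ 2 * (c i * (r v - r u)) := by
    apply nonneg_of_eventually_nonneg_quadratic (c := c i ^ 2 * ∑ x, δ x ^ 2 / w x)
    -- The bound t ≤ p i u keeps the mass left at u nonnegative.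
    filter_upwards [Ioc_mem_nhdsGT hpu] with t ht
    have hmem : Function.update p i (p i + t • δ) ∈ Set.univ.pi Δ := by
      intro k _
      by_cases hk : k = i
      · subst hk
        simp only [Function.update_self]
        refine ⟨⟨fun x => ?_, ?_⟩, fun x hx => ?_⟩
        · by_cases hx : x = u
          · subst hx
            by_cases hxv : x = v
            · subst hxv
              simp [δ, hpu.le]
            · simp [δ, hxv, ht.2]
          · have : 0 ≤ (Pi.single v 1 : V → ℝ) x := by
              rw [Pi.single_apply]; split_ifs <;> norm_num
            simp only [δ, Pi.add_apply, Pi.smul_apply, Pi.sub_apply, Pi.single_eq_of_ne hx,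
              sub_zero, smul_eq_mul]
            exact add_nonneg (hp0 _ _) (mul_nonneg ht.1.le this)
        · simp [sum_add_distrib, ← mul_sum, hδ, hp1]
        · have h1 : x ≠ u := fun h => hx (h ▸ hu)
          have h2 : x ≠ v := fun h => hx (h ▸ hv)
          simp [δ, h1, h2, hpA _ x hx]
      · simpa [Function.update_of_ne hk] using hp k trivial
    have hle := hmin hmem
    have hflow : ∀ x, b x + ∑ k, c k * Function.update p i (p i + t • δ) k x =
        w x * r x + c i * t * δ x := by
      intro x
      have : ∀ k, c k * Function.update p i (p i + t • δ) k x =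
          c k * p k x + if k = i then c i * t * δ x else 0 := by
        intro k
        by_cases hk : k = i
        · subst hk; simp; ring
        · simp [hk]
      simp only [this, sum_add_distrib, hr]
      simp
      ring
    simp only [Set.mem_ofPred_eq, hflow, ← hr] at hle
    have hexp : ∑ x, (w x * r x + c i * t * δ x) ^ 2 / w x = ∑ x, (w x * r x) ^ 2 / w x +
        (2 * (c i * ∑ x, r x * δ x) * t + c i ^ 2 * (∑ x, δ x ^ 2 / w x) * t ^ 2) := by
      simp only [mul_sum, sum_mul, ← sum_add_distrib]
      refine sum_congr rfl fun x _ => ?_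
      have := (hw x).ne'
      field_simp
      ring
    rw [hexp, hrδ] at hle
    linarith
  linarith

namespace MediatorHypergraph

variable {V E : Type*} [Fintype V] [DecidableEq V] [Fintype E]

/-! ### Extremal values on an edge and the variation of its energy -/

section Extremes

variable (H : MediatorHypergraph V E) (e : E) (f g : V → ℝ)

theorem le_fmax {u : V} (hu : u ∈ H.edge e) : f u ≤ H.fmax e f := le_sup' f hu

theorem fmin_le {u : V} (hu : u ∈ H.edge e) : H.fmin e f ≤ f u := inf'_le f hu

theorem fmin_le_fmax : H.fmin e f ≤ H.fmax e f := by
  obtain ⟨u, hu⟩ := H.edge_nonempty e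
  exact (H.fmin_le e f hu).trans (H.le_fmax e f hu)

theorem mem_S {u : V} : u ∈ H.S e f ↔ u ∈ H.edge e ∧ f u = H.fmax e f := by simp [S]

theorem mem_I {u : V} : u ∈ H.I e f ↔ u ∈ H.edge e ∧ f u = H.fmin e f := by simp [I]

theorem S_nonempty : (H.S e f).Nonempty := by
  obtain ⟨u, hu, h⟩ := exists_mem_eq_sup' (H.edge_nonempty e) f
  exact ⟨u, (H.mem_S e f).2 ⟨hu, h.symm⟩⟩

theorem I_nonempty : (H.I e f).Nonempty := by
  obtain ⟨u, hu, h⟩ := exists_mem_eq_inf' (H.edge_nonempty e) f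
  exact ⟨u, (H.mem_I e f).2 ⟨hu, h.symm⟩⟩

theorem maxDiff_eq : H.maxDiff e f = H.fmax e f - H.fmin e f := by
  apply le_antisymm
  · refine sup'_le _ _ fun p hp => ?_
    rw [mem_product] at hp
    exact sub_le_sub (H.le_fmax e f hp.1) (H.fmin_le e f hp.2)
  · obtain ⟨s, hs⟩ := H.S_nonempty e f
    obtain ⟨i, hi⟩ := H.I_nonempty e f
    rw [mem_S] at hs
    rw [mem_I] at hi
    rw [← hs.2, ← hi.2]
    exact le_sup' (fun p : V × V => f p.1 - f p.2) (b := (s, i)) (mem_product.2 ⟨hs.1, hi.1⟩)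

theorem maxSqDiff_eq : H.maxSqDiff e f = (H.fmax e f - H.fmin e f) ^ 2 := by
  apply le_antisymm
  · refine sup'_le _ _ fun p hp => ?_
    rw [mem_product] at hp
    apply sq_le_sq'
    · linarith [H.le_fmax e f hp.2, H.fmin_le e f hp.1]
    · linarith [H.le_fmax e f hp.1, H.fmin_le e f hp.2]
  · obtain ⟨s, hs⟩ := H.S_nonempty e f
    obtain ⟨i, hi⟩ := H.I_nonempty e f
    rw [mem_S] at hs
    rw [mem_I] at hi
    rw [← hs.2, ← hi.2]
    exact le_sup' (fun p : V × V => (f p.1 - f p.2) ^ 2) (b := (s, i))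
      (mem_product.2 ⟨hs.1, hi.1⟩)

theorem fmax_smul {c : ℝ} (hc : 0 ≤ c) : H.fmax e (c • f) = c * H.fmax e f := by
  apply le_antisymm
  · exact sup'_le _ _ fun u hu => mul_le_mul_of_nonneg_left (H.le_fmax e f hu) hc
  · obtain ⟨s, hs⟩ := H.S_nonempty e f
    rw [mem_S] at hs
    rw [← hs.2]
    exact H.le_fmax e (c • f) hs.1

theorem fmin_smul {c : ℝ} (hc : 0 ≤ c) : H.fmin e (c • f) = c * H.fmin e f := by
  apply le_antisymm
  · obtain ⟨s, hs⟩ := H.I_nonempty e f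
    rw [mem_I] at hs
    rw [← hs.2]
    exact H.fmin_le e (c • f) hs.1
  · exact le_inf' _ _ fun u hu => mul_le_mul_of_nonneg_left (H.fmin_le e f hu) hc

theorem beta_none_nonneg : 0 ≤ H.β e none := H.β_nonneg e _ none_mem_insertNone

theorem beta_some_nonneg {j : V} (hj : j ∈ H.edge e) : 0 ≤ H.β e (some j) :=
  H.β_nonneg e _ (some_mem_insertNone.2 hj)

theorem sum_idx {M : Type*} [AddCommMonoid M] (F : Option V → M) :
    ∑ j ∈ H.idx e, F j = F none + ∑ j ∈ H.edge e, F (some j) := by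
  rw [idx, sum_insertNone]

theorem vw_pos (u : V) : 0 < H.vw u := H.vertex_pos u

/-- Half the derivative of the energy of the edge `e` at `f` in the direction `g`, when the
maximum and the minimum of `f` over `e` change at the rates `a` and `b`. -/
noncomputable def variation (a b : ℝ) : ℝ :=
  H.w e * (H.β e none * ((H.fmax e f - H.fmin e f) * (a - b)) +
    ∑ j ∈ H.edge e, H.β e (some j) *
      ((H.fmax e f - f j) * (a - g j) + (f j - H.fmin e f) * (g j - b)))

theorem variation_neg (a b : ℝ) :
    H.variation e f (-g) (-a) (-b) = -H.variation e f g a b := by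
  rw [variation, variation, ← mul_neg, neg_add, ← sum_neg_distrib]
  congr 2
  · ring
  · refine sum_congr rfl fun j _ => ?_
    simp only [Pi.neg_apply]
    ring

/-- Euler's identity for a form homogeneous of degree two, in the direction of f itself. -/
theorem Q_eq_sum_variation :
    H.Q f = ∑ e, H.variation e f f (H.fmax e f) (H.fmin e f) := by
  simp only [Q, variation, maxSqDiff_eq, pow_two]

/-- The largest value of `g` on `S_e(f)`. -/
noncomputable def topRate : ℝ := (H.S e f).sup' (H.S_nonempty e f) g

/-- The smallest value of `g` on `I_e(f)`. -/
noncomputable def bottomRate : ℝ := (H.I e f).inf' (H.I_nonempty e f) g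

end Extremes

/-! ### Pairings with a diffusion rate, and uniqueness -/

namespace DiffusionRules

variable {H : MediatorHypergraph V E} {f r : V → ℝ} {φ : E → Option V → V → ℝ}

theorem rate_pairing (h : H.DiffusionRules f r φ) (g : V → ℝ) :
    ∑ u, H.vw u * r u * g u =
      ∑ e, ∑ j ∈ H.idx e, ∑ u ∈ H.edge e, φ e j u * g u := by
  have h1 : ∀ u, H.vw u * r u * g u =
      ∑ e, if u ∈ H.edge e then ∑ j ∈ H.idx e, φ e j u * g u else 0 := by
    intro u
    rw [h.rate, sum_mul, ← sum_filter]
    exact sum_congr rfl fun e _ => sum_mul ..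
  simp only [h1]
  rw [sum_comm]
  refine sum_congr rfl fun e _ => ?_
  rw [sum_comm (s := H.idx e), ← sum_filter]
  simp

/-- The part of the flow pairing at `(e, j)` that comes from the vertices other than `j`. -/
theorem pairing_ge_of_mem_idx (h : H.DiffusionRules f r φ) {e : E} {j : Option V}
    (hj : j ∈ H.idx e) (hlt : H.fmin e f < H.fmax e f) {T : Finset V}
    (hT : ∀ u, u ∈ T ↔ u ∈ H.edge e ∧ some u ≠ j) {g : V → ℝ} {a b : ℝ}
    (ha : ∀ u ∈ H.edge e, φ e j u < 0 → some u ≠ j → g u ≤ a)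
    (hb : ∀ u ∈ H.edge e, 0 < φ e j u → some u ≠ j → b ≤ g u) :
    a * ∑ u ∈ T with u ∈ H.S e f, φ e j u + b * ∑ u ∈ T with u ∈ H.I e f, φ e j u ≤
      ∑ u ∈ T, φ e j u * g u := by
  rw [sum_filter, sum_filter, mul_sum, mul_sum, ← sum_add_distrib]
  refine sum_le_sum fun u hu => ?_
  obtain ⟨hue, huj⟩ := (hT u).1 hu
  -- By `hlt` the sets S_e and I_e are disjoint, so each nonzero flow is counted in exactly one of
  -- the two sums.
  rcases lt_trichotomy (φ e j u) 0 with hneg | hzero | hpos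
  · have hS := h.lose e j hj u hue hneg huj
    have hI : u ∉ H.I e f := fun hI => by
      rw [mem_S] at hS
      rw [mem_I] at hI
      linarith [hS.2, hI.2]
    simp only [hS, hI, if_true, if_false]
    nlinarith [ha u hue hneg huj]
  · simp [hzero]
  · have hI := h.gain e j hj u hue hpos huj
    have hS : u ∉ H.S e f := fun hS => by
      rw [mem_S] at hS
      rw [mem_I] at hI
      linarith [hS.2, hI.2]
    simp only [hS, hI, if_true, if_false]
    nlinarith [hb u hue hpos huj]

/-- The total flows out of S_e, into I_e and at each mediator are prescribed. Replacing g by its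
upper bound a where measure leaves and by its lower bound b where it enters can only decrease the
pairing, and the result depends on these totals alone. -/
theorem neg_variation_le_pairing (h : H.DiffusionRules f r φ) (e : E) {g : V → ℝ} {a b : ℝ}
    (ha : ∀ j ∈ H.idx e, ∀ u ∈ H.edge e, φ e j u < 0 → some u ≠ j → g u ≤ a)
    (hb : ∀ j ∈ H.idx e, ∀ u ∈ H.edge e, 0 < φ e j u → some u ≠ j → b ≤ g u) :
    -H.variation e f g a b ≤ ∑ j ∈ H.idx e, ∑ u ∈ H.edge e, φ e j u * g u := by
  -- On a constant edge S_e and I_e coincide and cannot be separated, but there both sides vanish.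
  rcases (H.fmin_le_fmax e f).eq_or_lt with heq | hlt
  · have hφ := h.no_flow e heq.symm
    have h1 : ∑ j ∈ H.idx e, ∑ u ∈ H.edge e, φ e j u * g u = 0 :=
      sum_eq_zero fun j hj => sum_eq_zero fun u hu => by rw [hφ j hj u hu, zero_mul]
    have h2 : H.variation e f g a b = 0 := by
      rw [variation, sum_eq_zero, heq]
      · ring
      · intro j hj
        have h3 := H.le_fmax e f hj
        have h4 := H.fmin_le e f hj
        have h5 : f j = H.fmax e f := by linarith
        rw [heq, h5]
        ring
    rw [h1, h2, neg_zero]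
  · have hnone := h.pairing_ge_of_mem_idx (j := none) none_mem_insertNone hlt
      (T := H.edge e) (by simp) (ha _ none_mem_insertNone) (hb _ none_mem_insertNone)
    have hS : {u ∈ H.edge e | u ∈ H.S e f} = H.S e f := by
      ext u; simp [mem_S]
    have hI : {u ∈ H.edge e | u ∈ H.I e f} = H.I e f := by
      ext u; simp [mem_I]
    have hout := h.direct_out e
    have hin := h.direct_in e
    rw [maxDiff_eq] at hout hin
    rw [hS, hI, hin, neg_eq_iff_eq_neg.1 hout] at hnone
    have hsome : ∀ j ∈ H.edge e, -(H.w e * (H.β e (some j) *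
        ((H.fmax e f - f j) * (a - g j) + (f j - H.fmin e f) * (g j - b)))) ≤
        ∑ u ∈ H.edge e, φ e (some j) u * g u := by
      intro j hj
      have hj' : some j ∈ H.idx e := some_mem_insertNone.2 hj
      have hmed := h.pairing_ge_of_mem_idx hj' hlt (T := (H.edge e).erase j)
        (by intro u; simp [and_comm]) (ha _ hj') (hb _ hj')
      have hS : {u ∈ (H.edge e).erase j | u ∈ H.S e f} = (H.S e f).erase j := by
        ext u; simp only [mem_filter, mem_erase, mem_S]; tauto
      have hI : {u ∈ (H.edge e).erase j | u ∈ H.I e f} = (H.I e f).erase j := by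
        ext u; simp only [mem_filter, mem_erase, mem_I]; tauto
      rw [hS, hI, h.med_in e j hj, neg_eq_iff_eq_neg.1 (h.med_out e j hj)] at hmed
      rw [← add_sum_erase _ _ hj, h.med_net e j hj]
      linarith
    rw [H.sum_idx, variation, mul_add, neg_add, mul_sum, ← sum_neg_distrib]
    refine add_le_add ?_ (sum_le_sum hsome)
    linarith

/-- When g is constant on the losing and on the gaining vertices, the inequality applies to both g
and -g. -/
theorem pairing_eq_neg_variation (h : H.DiffusionRules f r φ) (e : E) {g : V → ℝ} {a b : ℝ}
    (ha : ∀ j ∈ H.idx e, ∀ u ∈ H.edge e, φ e j u < 0 → some u ≠ j → g u = a)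
    (hb : ∀ j ∈ H.idx e, ∀ u ∈ H.edge e, 0 < φ e j u → some u ≠ j → g u = b) :
    ∑ j ∈ H.idx e, ∑ u ∈ H.edge e, φ e j u * g u = -H.variation e f g a b := by
  apply le_antisymm
  · have := h.neg_variation_le_pairing e (g := -g) (a := -a) (b := -b)
      (fun j hj u hu h1 h2 => by simp [ha j hj u hu h1 h2])
      (fun j hj u hu h1 h2 => by simp [hb j hj u hu h1 h2])
    simp only [variation_neg, Pi.neg_apply, mul_neg, sum_neg_distrib] at this
    linarith
  · exact h.neg_variation_le_pairing e (fun j hj u hu h1 h2 => (ha j hj u hu h1 h2).le)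
      (fun j hj u hu h1 h2 => (hb j hj u hu h1 h2).ge)

theorem neg_variation_le_inner (h : H.DiffusionRules f r φ) (g : V → ℝ) :
    -∑ e, H.variation e f g (H.topRate e f g) (H.bottomRate e f g) ≤
      ∑ u, H.vw u * r u * g u := by
  rw [h.rate_pairing, ← sum_neg_distrib]
  exact sum_le_sum fun e _ => h.neg_variation_le_pairing e
    (fun j hj u hu h1 h2 => le_sup' g (h.lose e j hj u hu h1 h2))
    (fun j hj u hu h1 h2 => inf'_le g (h.gain e j hj u hu h1 h2))

/-- This is the use of (R3): losing vertices have the rate `topRate` and gaining ones `bottomRate`,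
so the general lower bound is attained at g = r. -/
theorem inner_self (h : H.DiffusionRules f r φ) :
    ∑ u, H.vw u * r u * r u =
      -∑ e, H.variation e f r (H.topRate e f r) (H.bottomRate e f r) := by
  rw [h.rate_pairing, ← sum_neg_distrib]
  exact sum_congr rfl fun e _ => h.pairing_eq_neg_variation e
    (fun j hj u hu h1 h2 => le_antisymm (le_sup' r (h.lose e j hj u hu h1 h2))
      (sup'_le _ _ (h.lose_first e j hj u hu h1 h2)))
    (fun j hj u hu h1 h2 => le_antisymm (le_inf' _ _ (h.gain_first e j hj u hu h1 h2))
      (inf'_le r (h.gain e j hj u hu h1 h2)))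

theorem inner_density (h : H.DiffusionRules f r φ) :
    ∑ u, H.vw u * r u * f u = -H.Q f := by
  rw [h.rate_pairing, Q_eq_sum_variation, ← sum_neg_distrib]
  exact sum_congr rfl fun e _ => h.pairing_eq_neg_variation e
    (fun j hj u hu h1 h2 => ((H.mem_S e f).1 (h.lose e j hj u hu h1 h2)).2)
    (fun j hj u hu h1 h2 => ((H.mem_I e f).1 (h.gain e j hj u hu h1 h2)).2)

/-- The diffusion process conserves the total measure. -/
theorem inner_one (h : H.DiffusionRules f r φ) : ∑ u, H.vw u * r u = 0 := by
  have h1 := h.rate_pairing fun _ => 1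
  have h2 : ∀ e, ∑ j ∈ H.idx e, ∑ u ∈ H.edge e, φ e j u * 1 = 0 := fun e => by
    rw [h.pairing_eq_neg_variation e (g := fun _ => 1) (a := 1) (b := 1)
      (fun _ _ _ _ _ _ => rfl) (fun _ _ _ _ _ _ => rfl)]
    simp [variation]
  rw [sum_congr rfl fun e _ => h2 e, sum_const_zero] at h1
  simpa only [mul_one] using h1

/-- Each rate tested against the other bounds ⟨r, r'⟩ below by both ‖r‖² and ‖r'‖². -/
theorem unique {r' : V → ℝ} {φ' : E → Option V → V → ℝ} (h : H.DiffusionRules f r φ)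
    (h' : H.DiffusionRules f r' φ') : r = r' := by
  have h1 := h.neg_variation_le_inner r'
  have h2 := h'.neg_variation_le_inner r
  rw [← h'.inner_self] at h1
  rw [← h.inner_self] at h2
  have h3 : ∑ u, H.vw u * (r u - r' u) ^ 2 ≤ 0 := by
    have : ∑ u, H.vw u * (r u - r' u) ^ 2 = ∑ u, H.vw u * r u * r u +
        ∑ u, H.vw u * r' u * r' u - ∑ u, H.vw u * r u * r' u - ∑ u, H.vw u * r' u * r u := by
      rw [← sum_add_distrib, ← sum_sub_distrib, ← sum_sub_distrib]
      exact sum_congr rfl fun u _ => by ring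
    linarith
  have hnn : ∀ u ∈ univ, 0 ≤ H.vw u * (r u - r' u) ^ 2 := fun u _ =>
    mul_nonneg (H.vw_pos u).le (sq_nonneg _)
  have h4 := (sum_eq_zero_iff_of_nonneg hnn).1 (le_antisymm h3 (sum_nonneg hnn))
  funext u
  have h5 := (mul_eq_zero.1 (h4 u (mem_univ u))).resolve_left (H.vw_pos u).ne'
  exact sub_eq_zero.1 (pow_eq_zero_iff two_ne_zero |>.1 h5)

end DiffusionRules

/-! ### Existence of a flow obeying the rules -/

theorem exists_diffusionRules (H : MediatorHypergraph V E) (f : V → ℝ) :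
    ∃ r φ, H.DiffusionRules f r φ := by
  classical
  -- The prescribed totals of (R2). The defaults of `Option.elim` make both totals for the index 0
  -- proportional to the full difference M_e - m_e.
  let out : E → Option V → ℝ := fun e j =>
    H.w e * H.β e j * (H.fmax e f - j.elim (H.fmin e f) f)
  let inn : E → Option V → ℝ := fun e j =>
    H.w e * H.β e j * (j.elim (H.fmax e f) f - H.fmin e f)
  have hout : ∀ e, ∀ j ∈ H.idx e, 0 ≤ out e j := by
    intro e j hj
    refine mul_nonneg (mul_nonneg (H.w_nonneg e) (H.β_nonneg e j hj)) (sub_nonneg.2 ?_)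
    cases j with
    | none => exact H.fmin_le_fmax e f
    | some j => exact H.le_fmax e f (some_mem_insertNone.1 hj)
  have hinn : ∀ e, ∀ j ∈ H.idx e, 0 ≤ inn e j := by
    intro e j hj
    refine mul_nonneg (mul_nonneg (H.w_nonneg e) (H.β_nonneg e j hj)) (sub_nonneg.2 ?_)
    cases j with
    | none => exact H.fmin_le_fmax e f
    | some j => exact H.fmin_le e f (some_mem_insertNone.1 hj)
  have hconst : ∀ e, H.fmax e f = H.fmin e f → ∀ j ∈ H.idx e, out e j = 0 ∧ inn e j = 0 := by
    intro e he j hj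
    have : j.elim (H.fmin e f) f = H.fmin e f ∧ j.elim (H.fmax e f) f = H.fmin e f := by
      cases j with
      | none => exact ⟨rfl, he⟩
      | some j =>
        have hj' := some_mem_insertNone.1 hj
        have h1 : f j = H.fmin e f :=
          le_antisymm (he ▸ H.le_fmax e f hj') (H.fmin_le e f hj')
        exact ⟨h1, h1⟩
    simp [out, inn, this, he]
  -- For each edge a single distribution on S_e and a single one on I_e serve all j ∈ [e]. The base
  -- flow is the net intake of u as its own mediator. The negative coefficient for S_e turns
  -- "smallest weighted rate" into "largest rate".
  obtain ⟨p, hp0, hpA, hp1, hp⟩ := exists_extremal_distribution H.vw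
    (fun u => ∑ e with u ∈ H.edge e, (out e (some u) - inn e (some u))) H.vw_pos
    (Sum.elim (fun e => H.S e f) (fun e => H.I e f))
    (by rintro (e | e); exacts [H.S_nonempty e f, H.I_nonempty e f])
    (Sum.elim (fun e => -∑ j ∈ H.idx e, out e j) (fun e => ∑ j ∈ H.idx e, inn e j))
  let P : E → V → ℝ := fun e => p (Sum.inl e)
  let N : E → V → ℝ := fun e => p (Sum.inr e)
  have hP0 : ∀ e u, 0 ≤ P e u := fun e => hp0 (Sum.inl e)
  have hN0 : ∀ e u, 0 ≤ N e u := fun e => hp0 (Sum.inr e)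
  have hPS : ∀ e, ∀ u ∉ H.S e f, P e u = 0 := fun e => hpA (Sum.inl e)
  have hNI : ∀ e, ∀ u ∉ H.I e f, N e u = 0 := fun e => hpA (Sum.inr e)
  have hP1 : ∀ e, ∑ u ∈ H.S e f, P e u = 1 := fun e => hp1 (Sum.inl e)
  have hN1 : ∀ e, ∑ u ∈ H.I e f, N e u = 1 := fun e => hp1 (Sum.inr e)
  have hSI : ∀ e u, u ∈ H.S e f → u ∈ H.I e f → H.fmax e f = H.fmin e f := by
    intro e u h1 h2
    rw [← ((H.mem_S e f).1 h1).2, ((H.mem_I e f).1 h2).2]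
  -- S_e and I_e meet only on a constant edge, where all prescribed flows are zero, so outflow never
  -- disturbs the sum over I_e, nor inflow the sum over S_e.
  have hIP : ∀ e, ∀ u ∈ H.I e f, ∀ j ∈ H.idx e, out e j * P e u = 0 := by
    intro e u hu j hj
    by_cases hS : u ∈ H.S e f
    · rw [(hconst e (hSI e u hS hu) j hj).1, zero_mul]
    · rw [hPS e u hS, mul_zero]
  have hSN : ∀ e, ∀ u ∈ H.S e f, ∀ j ∈ H.idx e, inn e j * N e u = 0 := by
    intro e u hu j hj
    by_cases hI : u ∈ H.I e f
    · rw [(hconst e (hSI e u hu hI) j hj).2, zero_mul]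
    · rw [hNI e u hI, mul_zero]
  have houtS : ∀ e, ∀ u ∈ H.S e f, out e (some u) = 0 := fun e u hu => by
    simp [out, ((H.mem_S e f).1 hu).2]
  have hinnI : ∀ e, ∀ u ∈ H.I e f, inn e (some u) = 0 := fun e u hu => by
    simp [inn, ((H.mem_I e f).1 hu).2]
  -- The shared distributions may put mass on the mediator itself. This is harmless: a mediator in
  -- S_e receives nothing from S_e, and one in I_e sends nothing to I_e.
  have hdiag : ∀ e u, inn e (some u) * N e u - out e (some u) * P e u = 0 := by
    intro e u
    have h1 : out e (some u) * P e u = 0 := by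
      by_cases hS : u ∈ H.S e f
      · rw [houtS e u hS, zero_mul]
      · rw [hPS e u hS, mul_zero]
    have h2 : inn e (some u) * N e u = 0 := by
      by_cases hI : u ∈ H.I e f
      · rw [hinnI e u hI, zero_mul]
      · rw [hNI e u hI, mul_zero]
    rw [h1, h2, sub_zero]
  let φ : E → Option V → V → ℝ := fun e j u =>
    if some u = j then out e j - inn e j else inn e j * N e u - out e j * P e u
  have hφ : ∀ e j u, some u ≠ j → φ e j u = inn e j * N e u - out e j * P e u :=
    fun e j u h => if_neg h
  let r : V → ℝ := fun u => (H.vw u)⁻¹ * ∑ e with u ∈ H.edge e, ∑ j ∈ H.idx e, φ e j u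
  have hr : ∀ u, H.vw u * r u = ∑ e with u ∈ H.edge e, ∑ j ∈ H.idx e, φ e j u := fun u => by
    rw [← mul_assoc, mul_inv_cancel₀ (H.vw_pos u).ne', one_mul]
  have hflow : ∀ u, H.vw u * r u =
      ∑ e with u ∈ H.edge e, (out e (some u) - inn e (some u)) +
        ∑ i, Sum.elim (fun e => -∑ j ∈ H.idx e, out e j) (fun e => ∑ j ∈ H.idx e, inn e j) i *
          p i u := by
    intro u
    have h1 : ∀ e, u ∈ H.edge e → ∑ j ∈ H.idx e, φ e j u =
        (out e (some u) - inn e (some u)) +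
          ((-∑ j ∈ H.idx e, out e j) * P e u + (∑ j ∈ H.idx e, inn e j) * N e u) := by
      intro e hu
      have hu' : some u ∈ H.idx e := some_mem_insertNone.2 hu
      rw [← add_sum_erase _ _ hu']
      congr 1
      · exact if_pos rfl
      · rw [sum_congr rfl fun j hj => hφ e j u (ne_of_mem_erase hj).symm,
          ← zero_add (∑ j ∈ _, _), ← hdiag e u,
          add_sum_erase _ (fun j => inn e j * N e u - out e j * P e u) hu',
          sum_sub_distrib, ← sum_mul, ← sum_mul]
        ring
    have h2 : ∀ e, u ∉ H.edge e →
        (-∑ j ∈ H.idx e, out e j) * P e u + (∑ j ∈ H.idx e, inn e j) * N e u = 0 := by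
      intro e hu
      rw [hPS e u fun h => hu ((H.mem_S e f).1 h).1, hNI e u fun h => hu ((H.mem_I e f).1 h).1]
      ring
    rw [Fintype.sum_sum_type, ← sum_add_distrib, hr,
      sum_congr rfl fun e he => h1 e (mem_filter.1 he).2, sum_add_distrib]
    congr 1
    refine sum_subset (subset_univ _) fun e _ he => h2 e fun h => he ?_
    exact mem_filter.2 ⟨mem_univ e, h⟩
  have hmax : ∀ e, ∀ j ∈ H.idx e, ∀ u, φ e j u < 0 → some u ≠ j →
      0 < out e j ∧ 0 < P e u := by
    intro e j hj u hneg hne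
    rw [hφ e j u hne] at hneg
    have h1 := mul_nonneg (hinn e j hj) (hN0 e u)
    refine ⟨(hout e j hj).lt_of_ne' fun h => ?_, (hP0 e u).lt_of_ne' fun h => ?_⟩ <;>
    · rw [h] at hneg
      linarith
  have hmin : ∀ e, ∀ j ∈ H.idx e, ∀ u, 0 < φ e j u → some u ≠ j →
      0 < inn e j ∧ 0 < N e u := by
    intro e j hj u hpos hne
    rw [hφ e j u hne] at hpos
    have h1 := mul_nonneg (hout e j hj) (hP0 e u)
    refine ⟨(hinn e j hj).lt_of_ne' fun h => ?_, (hN0 e u).lt_of_ne' fun h => ?_⟩ <;>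
    · rw [h] at hpos
      linarith
  have hlose : ∀ e, ∀ j ∈ H.idx e, ∀ u ∈ H.edge e, φ e j u < 0 → some u ≠ j →
      u ∈ H.S e f := fun e j hj u _ hneg hne =>
    by_contra fun h => (hmax e j hj u hneg hne).2.ne' (hPS e u h)
  have hgain : ∀ e, ∀ j ∈ H.idx e, ∀ u ∈ H.edge e, 0 < φ e j u → some u ≠ j →
      u ∈ H.I e f := fun e j hj u _ hpos hne =>
    by_contra fun h => (hmin e j hj u hpos hne).2.ne' (hNI e u h)
  have hsumS : ∀ e, ∀ j ∈ H.idx e, ∑ u ∈ H.S e f with some u ≠ j, φ e j u = -out e j := by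
    intro e j hj
    rw [sum_congr rfl fun u hu => hφ e j u (mem_filter.1 hu).2,
      sum_congr rfl fun u hu => by rw [hSN e u (mem_filter.1 hu).1 j hj, zero_sub],
      sum_neg_distrib, ← mul_sum]
    by_cases hex : ∃ s ∈ H.S e f, some s = j
    · obtain ⟨s, hs, rfl⟩ := hex
      rw [houtS e s hs, zero_mul]
    · rw [filter_true_of_mem (p := fun u => some u ≠ j) fun u hu h => hex ⟨u, hu, h⟩,
        hP1, mul_one]
  have hsumI : ∀ e, ∀ j ∈ H.idx e, ∑ u ∈ H.I e f with some u ≠ j, φ e j u = inn e j := by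
    intro e j hj
    rw [sum_congr rfl fun u hu => hφ e j u (mem_filter.1 hu).2,
      sum_congr rfl fun u hu => by rw [hIP e u (mem_filter.1 hu).1 j hj, sub_zero], ← mul_sum]
    by_cases hex : ∃ s ∈ H.I e f, some s = j
    · obtain ⟨s, hs, rfl⟩ := hex
      rw [hinnI e s hs, zero_mul]
    · rw [filter_true_of_mem (p := fun u => some u ≠ j) fun u hu h => hex ⟨u, hu, h⟩,
        hN1, mul_one]
  have hnone : ∀ T : Finset V, {u ∈ T | some u ≠ none} = T := fun T => by simp
  have hsome : ∀ (T : Finset V) (j : V), {u ∈ T | some u ≠ some j} = T.erase j := fun T j => by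
    ext u; simp [and_comm]
  refine ⟨r, φ, hr, hlose, hgain, fun e => ?_, fun e => ?_, fun e j hj => ?_, fun e j hj => ?_,
    fun e j hj => ?_, fun e he j hj u hu => ?_, fun e j hj u hu hneg hne s hs => ?_,
    fun e j hj u hu hpos hne i hi => ?_⟩
  · rw [← hnone (H.S e f), hsumS e none none_mem_insertNone, neg_neg, maxDiff_eq]
    rfl
  · rw [← hnone (H.I e f), hsumI e none none_mem_insertNone, maxDiff_eq]
    rfl
  · rw [← hsome, hsumS e _ (some_mem_insertNone.2 hj), neg_neg]
    rfl
  · rw [← hsome, hsumI e _ (some_mem_insertNone.2 hj)]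
    rfl
  · simp only [φ, if_true, out, inn, Option.elim]
    ring
  · obtain ⟨h1, h2⟩ := hconst e he j hj
    simp [φ, h1, h2]
  · obtain ⟨h1, h2⟩ := hmax e j hj u hneg hne
    have h3 : 0 < ∑ j ∈ H.idx e, out e j := sum_pos' (hout e) ⟨j, hj, h1⟩
    have h4 := hp r hflow (Sum.inl e) u (hlose e j hj u hu hneg hne) h2 s hs
    simp only [Sum.elim_inl] at h4
    nlinarith
  · obtain ⟨h1, h2⟩ := hmin e j hj u hpos hne
    have h3 : 0 < ∑ j ∈ H.idx e, inn e j := sum_pos' (hinn e) ⟨j, hj, h1⟩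
    have h4 := hp r hflow (Sum.inr e) u (hgain e j hj u hu hpos hne) h2 i hi
    exact le_of_mul_le_mul_left h4 h3

/-! ### One-sided expansion of the energy, and minimizers -/

open Filter Topology in
-- For small t > 0, vertices outside S_e stay below the bound by strict inequality at t = 0, and
-- those in S_e change at rate at most `topRate`.
theorem eventually_fmax_add_smul_le (H : MediatorHypergraph V E) (e : E) (f g : V → ℝ) :
    ∀ᶠ t in 𝓝[>] (0 : ℝ), H.fmax e (f + t • g) ≤ H.fmax e f + t * H.topRate e f g := by
  have h : ∀ u ∈ H.edge e,
      ∀ᶠ t in 𝓝[>] (0 : ℝ), f u + t * g u ≤ H.fmax e f + t * H.topRate e f g := by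
    intro u hu
    by_cases hS : u ∈ H.S e f
    · filter_upwards [self_mem_nhdsWithin] with t ht
      exact add_le_add (H.le_fmax e f hu)
        (mul_le_mul_of_nonneg_left (le_sup' g hS) (le_of_lt ht))
    · have hlt : f u < H.fmax e f :=
        (H.le_fmax e f hu).lt_of_ne fun h => hS ((H.mem_S e f).2 ⟨hu, h⟩)
      have hev : ∀ᶠ t in 𝓝 (0 : ℝ), f u + t * g u < H.fmax e f + t * H.topRate e f g :=
        ContinuousAt.eventually_lt (by fun_prop) (by fun_prop) (by simpa using hlt)
      exact (hev.filter_mono nhdsWithin_le_nhds).mono fun t ht => ht.le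
  filter_upwards [(eventually_all_finset _).2 h] with t ht
  exact sup'_le _ _ ht

theorem fmax_neg (H : MediatorHypergraph V E) (e : E) (f : V → ℝ) :
    H.fmax e (-f) = -H.fmin e f := by
  apply le_antisymm
  · exact sup'_le _ _ fun u hu => neg_le_neg (H.fmin_le e f hu)
  · obtain ⟨i, hi⟩ := H.I_nonempty e f
    rw [mem_I] at hi
    rw [← hi.2]
    exact H.le_fmax e (-f) hi.1

theorem topRate_neg (H : MediatorHypergraph V E) (e : E) (f g : V → ℝ) :
    H.topRate e (-f) (-g) = -H.bottomRate e f g := by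
  have hSI : H.S e (-f) = H.I e f := by
    ext u
    simp [mem_S, mem_I, fmax_neg]
  apply le_antisymm
  · exact sup'_le _ _ fun u hu => neg_le_neg (inf'_le g (hSI ▸ hu))
  · obtain ⟨i, hi, h⟩ := exists_mem_eq_inf' (H.I_nonempty e f) g
    rw [bottomRate, h]
    exact le_sup' (-g) (b := i) (by rwa [hSI])

open Filter Topology in
theorem eventually_le_fmin_add_smul (H : MediatorHypergraph V E) (e : E) (f g : V → ℝ) :
    ∀ᶠ t in 𝓝[>] (0 : ℝ), H.fmin e f + t * H.bottomRate e f g ≤ H.fmin e (f + t • g) := by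
  filter_upwards [H.eventually_fmax_add_smul_le e (-f) (-g)] with t ht
  rw [smul_neg, ← neg_add, fmax_neg, fmax_neg, topRate_neg] at ht
  linarith

open Filter Topology in
-- Q is monotone in the gaps M_e - m_e, M_e - f_j and f_j - m_e, so the linear bounds on the
-- extremes can be substituted. An upper bound suffices, since it is compared with the lower bound
-- coming from minimality.
theorem exists_eventually_Q_add_smul_le (H : MediatorHypergraph V E) (f g : V → ℝ) :
    ∃ C, ∀ᶠ t in 𝓝[>] (0 : ℝ), H.Q (f + t • g) ≤
      H.Q f + 2 * t * ∑ e, H.variation e f g (H.topRate e f g) (H.bottomRate e f g) +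
        C * t ^ 2 := by
  refine ⟨∑ e, H.w e * (H.β e none * (H.topRate e f g - H.bottomRate e f g) ^ 2 +
    ∑ j ∈ H.edge e, H.β e (some j) *
      ((H.topRate e f g - g j) ^ 2 + (g j - H.bottomRate e f g) ^ 2)), ?_⟩
  filter_upwards [eventually_all.2 fun e => H.eventually_fmax_add_smul_le e f g,
    eventually_all.2 fun e => H.eventually_le_fmin_add_smul e f g] with t hmax hmin
  rw [Q, Q, mul_sum, sum_mul, ← sum_add_distrib, ← sum_add_distrib]
  refine sum_le_sum fun e _ => ?_
  have hM := hmax e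
  have hm := hmin e
  have hle := H.fmin_le_fmax e (f + t • g)
  set a := H.topRate e f g
  set b := H.bottomRate e f g
  have hpow : ∀ x y : ℝ, 0 ≤ x → x ≤ y → x ^ 2 ≤ y ^ 2 := fun x y hx hy =>
    pow_le_pow_left₀ hx hy 2
  calc H.w e * (H.β e none * H.maxSqDiff e (f + t • g) + ∑ j ∈ H.edge e, H.β e (some j) *
        ((H.fmax e (f + t • g) - (f + t • g) j) ^ 2 + ((f + t • g) j - H.fmin e (f + t • g)) ^ 2))
      ≤ H.w e * (H.β e none * (H.fmax e f + t * a - (H.fmin e f + t * b)) ^ 2 +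
        ∑ j ∈ H.edge e, H.β e (some j) * ((H.fmax e f + t * a - (f j + t * g j)) ^ 2 +
          (f j + t * g j - (H.fmin e f + t * b)) ^ 2)) := by
        refine mul_le_mul_of_nonneg_left (add_le_add ?_ (sum_le_sum fun j hj => ?_))
          (H.w_nonneg e)
        · rw [maxSqDiff_eq]
          exact mul_le_mul_of_nonneg_left (hpow _ _ (by linarith) (by linarith))
            (H.beta_none_nonneg e)
        · have h1 := H.le_fmax e (f + t • g) hj
          have h2 := H.fmin_le e (f + t • g) hj
          simp only [Pi.add_apply, Pi.smul_apply, smul_eq_mul] at h1 h2 ⊢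
          exact mul_le_mul_of_nonneg_left (add_le_add (hpow _ _ (by linarith) (by linarith))
            (hpow _ _ (by linarith) (by linarith))) (H.beta_some_nonneg e hj)
    _ = _ := by
        rw [variation, maxSqDiff_eq]
        have hsum : ∑ j ∈ H.edge e, H.β e (some j) * ((H.fmax e f + t * a - (f j + t * g j)) ^ 2 +
            (f j + t * g j - (H.fmin e f + t * b)) ^ 2) =
            ∑ j ∈ H.edge e, H.β e (some j) * ((H.fmax e f - f j) ^ 2 + (f j - H.fmin e f) ^ 2) +
            2 * t * ∑ j ∈ H.edge e, H.β e (some j) *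
              ((H.fmax e f - f j) * (a - g j) + (f j - H.fmin e f) * (g j - b)) +
            (∑ j ∈ H.edge e, H.β e (some j) * ((a - g j) ^ 2 + (g j - b) ^ 2)) * t ^ 2 := by
          rw [mul_sum, sum_mul, ← sum_add_distrib, ← sum_add_distrib]
          exact sum_congr rfl fun j _ => by ring
        rw [hsum]
        ring

/-- A minimizer of the discrepancy ratio is moved by the diffusion process in its own direction. -/
theorem DiffusionRules.rate_eq_of_minimizer {H : MediatorHypergraph V E} {f r : V → ℝ}
    {φ : E → Option V → V → ℝ} (h : H.DiffusionRules f r φ) {γ : ℝ}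
    (hQ : H.Q f = γ * ∑ u, H.vw u * f u ^ 2) (hf : ∑ u, H.vw u * f u = 0)
    (hmin : ∀ g : V → ℝ, ∑ u, H.vw u * g u = 0 → γ * ∑ u, H.vw u * g u ^ 2 ≤ H.Q g) :
    r = -(γ • f) := by
  obtain ⟨C, hC⟩ := H.exists_eventually_Q_add_smul_le f r
  have hself := neg_eq_iff_eq_neg.2 h.inner_self
  have hdens := h.inner_density
  have hexp : ∀ s t : ℝ, ∑ u, H.vw u * (s * f u + t * r u) ^ 2 = s ^ 2 * ∑ u, H.vw u * f u ^ 2 +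
      2 * s * t * ∑ u, H.vw u * r u * f u + t ^ 2 * ∑ u, H.vw u * r u * r u := by
    intro s t
    simp only [mul_sum, ← sum_add_distrib]
    exact sum_congr rfl fun u _ => by ring
  -- Test minimality at f + t r, admissible because diffusion conserves total measure. The constant
  -- terms cancel by `hQ`, and the coefficient of t remains.
  have hineq : 0 ≤ 2 * (γ * H.Q f - ∑ u, H.vw u * r u * r u) := by
    apply nonneg_of_eventually_nonneg_quadratic (c := C - γ * ∑ u, H.vw u * r u * r u)
    filter_upwards [hC] with t ht
    have horth : ∑ u, H.vw u * (f + t • r) u = 0 := by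
      simp only [Pi.add_apply, Pi.smul_apply, smul_eq_mul, mul_add, sum_add_distrib, hf,
        mul_left_comm _ t, ← mul_sum, h.inner_one]
      simp
    have h1 := hmin _ horth
    have h2 := hexp 1 t
    simp only [one_mul] at h2
    simp only [Pi.add_apply, Pi.smul_apply, smul_eq_mul] at h1
    rw [h2, hdens] at h1
    rw [← hself] at ht
    linarith
  -- Expanded, the sum is γ²‖f‖² - 2γQ(f) + ‖r‖², and γ²‖f‖² = γQ(f).
  have hsq : ∑ u, H.vw u * (γ * f u + 1 * r u) ^ 2 ≤ 0 := by
    rw [hexp, hdens]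
    linarith [congrArg (γ * ·) hQ]
  have hnn : ∀ u ∈ univ, 0 ≤ H.vw u * (γ * f u + 1 * r u) ^ 2 := fun u _ =>
    mul_nonneg (H.vw_pos u).le (sq_nonneg _)
  have hzero := (sum_eq_zero_iff_of_nonneg hnn).1 (le_antisymm hsq (sum_nonneg hnn))
  funext u
  have h5 := (mul_eq_zero.1 (hzero u (mem_univ u))).resolve_left (H.vw_pos u).ne'
  have h6 := pow_eq_zero_iff two_ne_zero |>.1 h5
  simp only [Pi.neg_apply, Pi.smul_apply, smul_eq_mul]
  linarith

/-! ### Normalized coordinates and existence of the minimum -/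

section Normalization

variable (H : MediatorHypergraph V E)

theorem sqrt_vw_pos (u : V) : 0 < √(H.vw u) := Real.sqrt_pos.2 (H.vw_pos u)

theorem toNormalized_toDensity (x : V → ℝ) : H.toNormalized (H.toDensity x) = x := by
  funext u
  simp [toNormalized, toDensity, (H.sqrt_vw_pos u).ne']

theorem toDensity_toNormalized (f : V → ℝ) : H.toDensity (H.toNormalized f) = f := by
  funext u
  simp [toNormalized, toDensity, (H.sqrt_vw_pos u).ne']

theorem toNormalized_dotProduct (f g : V → ℝ) :
    H.toNormalized f ⬝ᵥ H.toNormalized g = ∑ u, H.vw u * f u * g u := by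
  refine sum_congr rfl fun u _ => ?_
  have := Real.mul_self_sqrt (H.vw_pos u).le
  simp only [toNormalized]
  linear_combination f u * g u * this

theorem Q_smul {c : ℝ} (hc : 0 ≤ c) (f : V → ℝ) : H.Q (c • f) = c ^ 2 * H.Q f := by
  rw [Q, Q, mul_sum]
  refine sum_congr rfl fun e _ => ?_
  simp only [maxSqDiff_eq, H.fmax_smul e f hc, H.fmin_smul e f hc, Pi.smul_apply, smul_eq_mul]
  rw [mul_left_comm, mul_add (c ^ 2), mul_sum]
  congr 2
  · ring
  · exact sum_congr rfl fun j _ => by ring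

theorem continuous_Q : Continuous H.Q := by
  have h1 : ∀ e, Continuous (H.fmax e) := fun e =>
    Continuous.finset_sup'_apply _ fun u _ => continuous_apply u
  have h2 : ∀ e, Continuous (H.fmin e) := fun e =>
    Continuous.finset_inf'_apply _ fun u _ => continuous_apply u
  unfold Q
  simp only [maxSqDiff_eq]
  fun_prop

theorem D_eq (x : V → ℝ) : H.D x = H.Q (H.toDensity x) / (x ⬝ᵥ x) := by
  have h := H.toNormalized_dotProduct (H.toDensity x) (H.toDensity x)
  rw [toNormalized_toDensity] at h
  rw [h, D, Dw]
  simp only [pow_two, mul_assoc]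

theorem D_smul {c : ℝ} (hc : 0 < c) (x : V → ℝ) : H.D (c • x) = H.D x := by
  have h : H.toDensity (c • x) = c • H.toDensity x := by
    funext u
    simp only [toDensity, Pi.smul_apply, smul_eq_mul]
    ring
  rw [D_eq, D_eq, h, H.Q_smul hc.le, smul_dotProduct, dotProduct_smul, smul_eq_mul, smul_eq_mul,
    ← mul_assoc, ← pow_two, mul_div_mul_left _ _ (pow_pos hc 2).ne']

theorem feasible_nonempty [Nontrivial V] : H.feasible.Nonempty := by
  obtain ⟨u, v, huv⟩ := exists_pair_ne V
  -- With the square roots of the weights swapped, the two contributions to the pairing with W^{1/2}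
  -- 1 cancel.
  refine ⟨Pi.single u √(H.vw v) - Pi.single v √(H.vw u), fun h => ?_, ?_⟩
  · have := congrFun h u
    simp [huv, (H.sqrt_vw_pos v).ne'] at this
  · simp [sub_dotProduct, toNormalized, mul_comm]

/-- Scale invariance of the ratio reduces the problem to the unit sphere of the hyperplane, which is
compact and on which the ratio is continuous. Any norm would do, here the sup norm. -/
theorem exists_isLeast_D [Nontrivial V] : ∃ γ, IsLeast (H.D '' H.feasible) γ := by
  let K : Set (V → ℝ) := Metric.sphere 0 1 ∩ {x | x ⬝ᵥ H.toNormalized 1 = 0}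
  have hscale : ∀ x ∈ H.feasible, ‖x‖⁻¹ • x ∈ K ∧ H.D (‖x‖⁻¹ • x) = H.D x := by
    intro x hx
    have hpos : 0 < ‖x‖ := norm_pos_iff.2 hx.1
    refine ⟨⟨?_, ?_⟩, H.D_smul (inv_pos.2 hpos) x⟩
    · rw [mem_sphere_zero_iff_norm, norm_smul, norm_inv, norm_norm, inv_mul_cancel₀ hpos.ne']
    · change (‖x‖⁻¹ • x) ⬝ᵥ H.toNormalized 1 = 0
      rw [smul_dotProduct, hx.2, smul_zero]
  have hK : IsCompact K := (isCompact_sphere 0 1).inter_right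
    (isClosed_eq (by unfold dotProduct; fun_prop) continuous_const)
  have hK0 : ∀ x ∈ K, x ≠ 0 := by
    rintro x hx rfl
    simpa using hx.1
  have hcont : ContinuousOn H.D K := by
    have h : H.D = fun x => H.Q (H.toDensity x) / (x ⬝ᵥ x) := funext H.D_eq
    rw [h]
    refine ContinuousOn.div (H.continuous_Q.comp ?_).continuousOn ?_ fun x hx h0 =>
      hK0 x hx (dotProduct_self_eq_zero.1 h0)
    · unfold toDensity
      fun_prop
    · unfold dotProduct
      fun_prop
  obtain ⟨y, hy⟩ := H.feasible_nonempty
  obtain ⟨x, hx, hmin⟩ := hK.exists_isMinOn ⟨_, (hscale y hy).1⟩ hcont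
  refine ⟨H.D x, ⟨x, ⟨hK0 x hx, hx.2⟩, rfl⟩, ?_⟩
  rintro _ ⟨z, hz, rfl⟩
  rw [← (hscale z hz).2]
  exact hmin (hscale z hz).1

end Normalization

end MediatorHypergraph

/-! ### The normalized Laplacian, its Rayleigh quotient and its eigenvalue -/

theorem theorem2 {V E : Type*} [Fintype V] [DecidableEq V] [Fintype E]
    (H : MediatorHypergraph V E) :
    ∃ L : (V → ℝ) → V → ℝ,
      H.IsNormalizedLaplacian L ∧
      (∀ x, x ≠ 0 → rayleigh L x = H.D x) ∧
      (Nontrivial V →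
        ∃ γ₂ : ℝ, IsLeast (H.D '' H.feasible) γ₂ ∧
          (∃ x, x ≠ 0 ∧ L x = γ₂ • x) ∧
          (∀ x ∈ H.feasible, H.D x = γ₂ → L x = γ₂ • x)) := by
  choose r φ h using H.exists_diffusionRules
  refine ⟨fun x => H.toNormalized (-r (H.toDensity x)), ⟨fun f => -r f, fun f r' => ?_,
    fun x => rfl⟩, fun x _ => ?_, fun _ => ?_⟩
  · rw [neg_neg]
    refine ⟨fun ⟨φ', h'⟩ => h'.unique (h f), ?_⟩
    rintro rfl
    exact ⟨φ f, h f⟩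
  · rw [H.D_eq, rayleigh]
    congr 1
    nth_rw 1 [← H.toNormalized_toDensity x]
    rw [H.toNormalized_dotProduct, ← neg_eq_iff_eq_neg.2 (h (H.toDensity x)).inner_density,
      ← sum_neg_distrib]
    refine sum_congr rfl fun u _ => ?_
    simp only [Pi.neg_apply]
    ring
  · obtain ⟨γ, hγ⟩ := H.exists_isLeast_D
    have heigen : ∀ x ∈ H.feasible, H.D x = γ →
        H.toNormalized (-r (H.toDensity x)) = γ • x := by
      intro x hx hD
      have horth : ∀ g : V → ℝ, H.toNormalized g ⬝ᵥ H.toNormalized 1 = ∑ u, H.vw u * g u :=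
        fun g => by simp [H.toNormalized_dotProduct]
      have hsq : ∀ g : V → ℝ, H.toNormalized g ⬝ᵥ H.toNormalized g = ∑ u, H.vw u * g u ^ 2 :=
        fun g => by simp only [H.toNormalized_dotProduct, pow_two, mul_assoc]
      have hr := (h (H.toDensity x)).rate_eq_of_minimizer (γ := γ) ?_ ?_ fun g hg => ?_
      · rw [hr, neg_neg]
        funext u
        have := congrFun (H.toNormalized_toDensity x) u
        simp only [MediatorHypergraph.toNormalized, Pi.smul_apply, smul_eq_mul] at this ⊢
        rw [mul_left_comm, this]
      · rw [← hsq, H.toNormalized_toDensity, ← hD, H.D_eq, div_mul_cancel₀]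
        exact fun h0 => hx.1 (dotProduct_self_eq_zero.1 h0)
      · rw [← horth, H.toNormalized_toDensity]
        exact hx.2
      · rw [← hsq]
        by_cases hg0 : H.toNormalized g = 0
        -- The zero vector is not feasible and is treated apart; in this form homogeneity gives Q(0)
        -- = 0.
        · have : g = (0 : ℝ) • (0 : V → ℝ) := by
            rw [← H.toDensity_toNormalized g, hg0]
            funext u
            simp [MediatorHypergraph.toDensity]
          rw [hg0, this, H.Q_smul le_rfl]
          simp
        · have h1 := hγ.2 ⟨_, ⟨hg0, (horth g).trans hg⟩, rfl⟩
          have hpos : 0 < H.toNormalized g ⬝ᵥ H.toNormalized g :=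
            (sum_nonneg fun u _ => mul_self_nonneg _).lt_of_ne' fun h0 => hg0 (dotProduct_self_eq_zero.1 h0)
          rwa [H.D_eq, H.toDensity_toNormalized, le_div_iff₀ hpos] at h1
    refine ⟨γ, hγ, ?_, heigen⟩
    obtain ⟨x, hx, hD⟩ := hγ.1
    exact ⟨x, hx.1, heigen x hx hD⟩
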